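/- Let $J$ be a finite set of activities with durations $d_j\in\mathbb{Z}_{\ge 0}$, let $\mathcal{T}=\{0,\dots,T-1\}$, let $\underline{c},\hat c\in\mathbb{R}^{J\times\mathcal{T}}$ (lower bounds and deviations of the start-time dependent costs) and let $\Gamma\in\mathbb{R}$, $\Gamma\ge 0$. All sums over times $s$ run over $s\in\mathcal{T}$ only. Let $\mathcal{Y}$ be the set of $y\in\{0,1\}^{J\times J}$ with $y_{ii}=0$ for all $i$, $y_{ij}+y_{ji}=1$ for all $i\neq j$, and $y_{ij}+y_{jk}\le 1+y_{ik}$ for all pairwise different $i,j,k$. For $y\in\mathcal{Y}$ let $\mathcal{X}(y)$ be the set of $x\in\{0,1\}^{J\times\mathcal{T}}$ with $\sum_{t\in\mathcal{T}}x_{jt}=1$ for all $j$ and $$\sum_{s=t}^{T-1}x_{is}+\sum_{s=0}^{t+d_i-1}x_{js}\le 1\qquad\text{for all } t\in\mathcal{T}\text{ and all } (i,j)\text{ with } y_{ij}=1.$$ Let $$\mathcal{U}_C(\Gamma)=\Big\{c\in\mathbb{R}^{J\times\mathcal{T}}:\ c_{jt}=\underline{c}_{jt}+\hat c_{jt}\delta_{jt},\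 \delta_{jt}\in[0,1],\ \sum_{j\in J}\sum_{t\in\mathcal{T}}\delta_{jt}\le\Gamma\Big\}.$$ Consider the two-stage robust problem $$\min_{y\in\mathcal{Y}}\ \max_{c\in\mathcal{U}_C(\Gamma)}\ \min_{x\in\mathcal{X}(y)}\ \sum_{j\in J}\sum_{t\in\mathcal{T}}c_{jt}x_{jt}\tag{R}$$ (a minimum over the empty set being $+\infty$) and the single-level mixed-integer program in the variables $x,y,\pi,\eta$ \begin{align*} \min\ & \sum_{j\in J}\sum_{t\in\mathcal{T}}\underline{c}_{jt}x_{jt}+\Gamma\pi+\sum_{j\in J}\sum_{t\in\mathcal{T}}\eta_{jt}\tag{C}\\ \text{s.t. } & \sum_{t\in\mathcal{T}}x_{jt}=1 && \forall j\in J,\\ & \sum_{s=t}^{T-1}x_{is}+\sum_{s=0}^{t+d_i-1}x_{js}\le 1+(1-y_{ij}) && \forall i,j\in J,\ t\in\mathcal{T},\\ & \pi+\eta_{jt}\ge\hat c_{jt}x_{jt} && \forall j\in J,\ t\in\mathcal{T},\\ & y_{ii}=0 && \forall i\in J,\\ & y_{ij}+y_{ji}=1 && \forall i,j\in J,\ i\ne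 j,\\ & y_{ij}+y_{jk}\le 1+y_{ik} && \forall i,j,k\in J\text{ pairwise different},\\ & y_{ij}\in\{0,1\} && \forall i,j\in J,\\ & x_{jt}\ge 0,\ \eta_{jt}\ge 0 && \forall j\in J,\ t\in\mathcal{T},\\ & \pi\ge 0. \end{align*} Then (R) and (C) are equivalent: their optimal values in $\mathbb{R}\cup\{+\infty\}$ coincide. More precisely, for every $y\in\mathcal{Y}$, the set $\mathcal{X}(y)$ is nonempty if and only if (C) has a feasible solution with ordering $y$, and the value $\max_{c\in\mathcal{U}_C(\Gamma)}\min_{x\in\mathcal{X}(y)}\sum_{j,t}c_{jt}x_{jt}$ equals the optimal value of (C) with $y$ fixed. Moreover $y$ is an optimal first-stage solution of (R) (that is, $y\in\mathcal{Y}$, $\mathcal{X}(y)\ne\emptyset$, and $y$ minimizes the worst-case value over $\mathcal{Y}$) if and only if $y$ is the ordering part of an optimal solution of (C). All minima and maxima in (R) are attained (the minimum over $\mathcal{X}(y)$ whenever $\mathcal{X}(y)\neq\emptyset$), and (C) has an optimal solution whenever it is feasible. -/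

import Mathlib

namespace RobustScheduling

/-- The set `Y` of complete orderings of the activities, encoded by binary precedence variables:
`y i j = 1` if activity `i` precedes activity `j`, and `y i j = 0` otherwise. -/
def orderings (J : Type*) : Set (J → J → ℝ) :=
  {y | (∀ i j, y i j = 0 ∨ y i j = 1) ∧
       (∀ i, y i i = 0) ∧
       (∀ i j, i ≠ j → y i j + y j i = 1) ∧
       (∀ i j k, i ≠ j → j ≠ k → i ≠ k → y i j + y j k ≤ 1 + y i k)}

/-- The precedence relation `P(y)`. -/
def precedences {J : Type*} (y : J → J → ℝ) : Set (J × J) :=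
  {p | y p.1 p.2 = 1}

/-- For an activity `i` of duration `di` and an activity `j`, the expression
`∑_{s=t}^{T-1} x_{is} + ∑_{s=0}^{t+di-1} x_{js}`, where `s` ranges over the time horizon
`{0, …, T-1}`; the bound `s ≤ t + di - 1` is written `s < t + di`. -/
def overlap {J : Type*} {T : ℕ} (x : J → Fin T → ℝ) (i j : J) (di : ℕ) (t : Fin T) : ℝ :=
  (∑ s : Fin T with t ≤ s, x i s) + ∑ s : Fin T with s.val < t.val + di, x j s

/-- The set `X(y)` of (integral) schedules that adhere to the ordering `y`. -/
def schedules {J : Type*} {T : ℕ} (d : J → ℕ) (y : J → J → ℝ) : Set (J → Fin T → ℝ) :=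
  {x | (∀ j t, x j t = 0 ∨ x j t = 1) ∧
       (∀ j, ∑ t, x j t = 1) ∧
       (∀ p ∈ precedences y, ∀ t, overlap x p.1 p.2 (d p.1) t ≤ 1)}

/-- The continuous budgeted uncertainty set `U_C(Γ)`. -/
def budgetedSet {J : Type*} [Fintype J] {T : ℕ} (cLow cHat : J → Fin T → ℝ) (Γ : ℝ) :
    Set (J → Fin T → ℝ) :=
  {c | ∃ δ : J → Fin T → ℝ,
       (∀ j t, 0 ≤ δ j t ∧ δ j t ≤ 1) ∧
       ∑ j, ∑ t, δ j t ≤ Γ ∧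
       ∀ j t, c j t = cLow j t + cHat j t * δ j t}

/-- The total start-time dependent cost of `x` in scenario `c`. -/
def cost {J : Type*} [Fintype J] {T : ℕ} (c x : J → Fin T → ℝ) : ℝ :=
  ∑ j, ∑ t, c j t * x j t

/-- The second-stage value `min_{x ∈ X(y)} ∑ c x` (`⊤ = +∞` if `X(y)` is empty). -/
noncomputable def recourseValue {J : Type*} [Fintype J] {T : ℕ} (d : J → ℕ)
    (y : J → J → ℝ) (c : J → Fin T → ℝ) : EReal :=
  ⨅ x ∈ schedules (T := T) d y, (cost c x : EReal)

/-- The adversarial value `max_{c ∈ U_C(Γ)} min_{x ∈ X(y)} ∑ c x` of the ordering `y`. -/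
noncomputable def worstCaseValue {J : Type*} [Fintype J] {T : ℕ} (d : J → ℕ)
    (cLow cHat : J → Fin T → ℝ) (Γ : ℝ) (y : J → J → ℝ) : EReal :=
  ⨆ c ∈ budgetedSet cLow cHat Γ, recourseValue d y c

/-- The value `min_{y ∈ Y} max_{c ∈ U_C(Γ)} min_{x ∈ X(y)} ∑ c x` of the two-stage robust
problem. -/
noncomputable def twoStageValue {J : Type*} [Fintype J] {T : ℕ} (d : J → ℕ)
    (cLow cHat : J → Fin T → ℝ) (Γ : ℝ) : EReal :=
  ⨅ y ∈ orderings J, worstCaseValue d cLow cHat Γ y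

/-- An optimal first-stage decision of the two-stage robust problem: an ordering that admits a
schedule and has the least worst-case value. -/
def IsOptimalOrdering {J : Type*} [Fintype J] {T : ℕ} (d : J → ℕ)
    (cLow cHat : J → Fin T → ℝ) (Γ : ℝ) (y : J → J → ℝ) : Prop :=
  y ∈ orderings J ∧ (schedules (T := T) d y).Nonempty ∧
    ∀ y' ∈ orderings J, worstCaseValue d cLow cHat Γ y ≤ worstCaseValue d cLow cHat Γ y'

/-- An assignment of values to the variables of the compact mixed-integer program. -/
structure CompactPoint (J : Type*) (T : ℕ) where
  /-- start-time variables (continuous) -/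
  x : J → Fin T → ℝ
  /-- precedence variables -/
  y : J → J → ℝ
  /-- the variable multiplied by the budget in the objective -/
  π : ℝ
  /-- the activity-time indexed variables summed in the objective -/
  η : J → Fin T → ℝ

/-- The feasible set of the compact mixed-integer program. -/
def compactFeasible {J : Type*} {T : ℕ} (d : J → ℕ) (cHat : J → Fin T → ℝ) :
    Set (CompactPoint J T) :=
  {p | (∀ j, ∑ t, p.x j t = 1) ∧
       (∀ i j t, overlap p.x i j (d i) t ≤ 1 + (1 - p.y i j)) ∧
       (∀ j t, cHat j t * p.x j t ≤ p.π + p.η j t) ∧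
       (∀ i, p.y i i = 0) ∧
       (∀ i j, i ≠ j → p.y i j + p.y j i = 1) ∧
       (∀ i j k, i ≠ j → j ≠ k → i ≠ k → p.y i j + p.y j k ≤ 1 + p.y i k) ∧
       (∀ i j, p.y i j = 0 ∨ p.y i j = 1) ∧
       (∀ j t, 0 ≤ p.x j t) ∧
       (∀ j t, 0 ≤ p.η j t) ∧
       0 ≤ p.π}

/-- The objective of the compact mixed-integer program. -/
def compactObjective {J : Type*} [Fintype J] {T : ℕ} (cLow : J → Fin T → ℝ) (Γ : ℝ)
    (p : CompactPoint J T) : ℝ :=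
  (∑ j, ∑ t, cLow j t * p.x j t) + Γ * p.π + ∑ j, ∑ t, p.η j t

/-- The optimal value of the compact mixed-integer program (`⊤ = +∞` if it is infeasible). -/
noncomputable def compactValue {J : Type*} [Fintype J] {T : ℕ} (d : J → ℕ)
    (cLow cHat : J → Fin T → ℝ) (Γ : ℝ) : EReal :=
  ⨅ p ∈ compactFeasible d cHat, (compactObjective cLow Γ p : EReal)

/-- An optimal solution of the compact mixed-integer program. -/
def IsCompactOptimal {J : Type*} [Fintype J] {T : ℕ} (d : J → ℕ)
    (cLow cHat : J → Fin T → ℝ) (Γ : ℝ) (p : CompactPoint J T) : Prop :=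
  p ∈ compactFeasible d cHat ∧
    ∀ q ∈ compactFeasible d cHat, compactObjective cLow Γ p ≤ compactObjective cLow Γ q

end RobustScheduling

/-! Fix an ordering `y`. Since each activity has total weight one, a precedence constraint compares
cumulative weights: that of `j` at `t + d i` is at most that of `i` at `t`. Starting every activity
when its cumulative weight reaches a common level `θ` preserves this, and the average over `θ ∈ (0,
1]` recovers the fractional point, so some `θ` costs no more (`exists_schedule_cost_le`). Hence the
recourse problem may be relaxed to a compact convex set. The budget constraint is then dualized with
multiplier `π`, and Sion's theorem gives a saddle point. Maximizing over the box of `δ` turns `η`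
into the positive part of `cHat * x - π`, which yields strong duality
(`exists_compactObjective_le_cost`); weak duality is `cost_le_compactObjective`. Attainment over `y`
holds because there are finitely many orderings. -/

namespace RobustScheduling

open MeasureTheory

/-! ### Integrality of the recourse problem by threshold rounding. -/

section Relaxation

variable {J : Type*} {T : ℕ}

/-- The linear relaxation of `schedules d y`. -/
def relaxedSchedules (d : J → ℕ) (y : J → J → ℝ) : Set (J → Fin T → ℝ) :=
  {x | (∀ j t, 0 ≤ x j t) ∧
       (∀ j, ∑ t, x j t = 1) ∧
       (∀ p ∈ precedences y, ∀ t, overlap x p.1 p.2 (d p.1) t ≤ 1)}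

theorem schedules_subset_relaxedSchedules (d : J → ℕ) (y : J → J → ℝ) :
    schedules (T := T) d y ⊆ relaxedSchedules d y := by
  rintro x ⟨h01, h1, h2⟩
  refine ⟨fun j t => ?_, h1, h2⟩
  rcases h01 j t with h | h <;> simp [h]

/-- The total weight that `u` puts on times before `n`. -/
def prefixSum (u : Fin T → ℝ) (n : ℕ) : ℝ := ∑ s : Fin T with s.val < n, u s

theorem prefixSum_zero (u : Fin T → ℝ) : prefixSum u 0 = 0 := by simp [prefixSum]

theorem prefixSum_succ (u : Fin T → ℝ) (t : Fin T) :
    prefixSum u (t.val + 1) = prefixSum u t.val + u t := by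
  have : (Finset.univ.filter fun s : Fin T => s.val < t.val + 1) =
      insert t (Finset.univ.filter fun s : Fin T => s.val < t.val) := by
    ext s
    simp only [Finset.mem_filter, Finset.mem_univ, true_and, Finset.mem_insert, Fin.ext_iff]
    omega
  rw [prefixSum, this, Finset.sum_insert (by simp), prefixSum, add_comm]

theorem prefixSum_of_le (u : Fin T → ℝ) {n : ℕ} (h : T ≤ n) : prefixSum u n = ∑ t, u t := by
  rw [prefixSum, Finset.filter_true_of_mem fun s _ => s.isLt.trans_le h]

theorem prefixSum_mono {u : Fin T → ℝ} (hu : ∀ t, 0 ≤ u t) : Monotone (prefixSum u) := by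
  intro m n h
  refine Finset.sum_le_sum_of_subset_of_nonneg ?_ fun t _ _ => hu t
  intro s
  simp only [Finset.mem_filter, Finset.mem_univ, true_and]
  omega

theorem overlap_eq (x : J → Fin T → ℝ) (i j : J) (n : ℕ) (t : Fin T) :
    overlap x i j n t = (∑ s, x i s) - prefixSum (x i) t + prefixSum (x j) (t + n) := by
  have h := Finset.sum_filter_add_sum_filter_not Finset.univ (fun s : Fin T => s.val < t.val) (x i)
  have h' : (Finset.univ.filter fun s : Fin T => ¬ s.val < t.val) =
      Finset.univ.filter fun s : Fin T => t ≤ s := by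
    ext s; simp only [Finset.mem_filter, Finset.mem_univ, true_and, not_lt, Fin.le_def]
  rw [h'] at h
  rw [overlap, ← h, prefixSum, prefixSum]
  ring

/-- Rounding at level `θ`: each activity starts when its cumulative weight reaches `θ`. -/
noncomputable def thresholdRounding (x : J → Fin T → ℝ) (θ : ℝ) : J → Fin T → ℝ := fun j t =>
  (Set.Ioc (prefixSum (x j) t) (prefixSum (x j) (t + 1))).indicator 1 θ

/-- The half-open intervals between successive prefix sums are disjoint, so `θ` is crossed at most
once; `0 < θ` settles the empty prefix. -/
theorem prefixSum_thresholdRounding {x : J → Fin T → ℝ} (hx : ∀ j t, 0 ≤ x j t) {θ : ℝ}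
    (hθ : 0 < θ) (j : J) (n : ℕ) :
    prefixSum (thresholdRounding x θ j) n = if θ ≤ prefixSum (x j) n then 1 else 0 := by
  induction n with
  | zero => rw [prefixSum_zero, prefixSum_zero, if_neg hθ.not_ge]
  | succ n ih =>
    by_cases h : n < T
    · have hs := prefixSum_succ (thresholdRounding x θ j) ⟨n, h⟩
      have hm := prefixSum_mono (hx j) (Nat.le_succ n)
      simp only [Nat.succ_eq_add_one] at hm
      simp only at hs
      rw [hs, ih, thresholdRounding]
      by_cases h1 : θ ≤ prefixSum (x j) n
      · simp [h1, h1.trans hm, Set.indicator, h1.not_gt]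
      · simp [h1, Set.indicator, not_le.mp h1]
    -- Past the horizon both prefix sums are constant.
    · have h' : T ≤ n := not_lt.mp h
      rw [prefixSum_of_le _ (h'.trans n.le_succ), prefixSum_of_le _ (h'.trans n.le_succ),
        ← prefixSum_of_le _ h', ← prefixSum_of_le (x j) h', ih]

theorem thresholdRounding_mem_schedules {d : J → ℕ} {y : J → J → ℝ} {x : J → Fin T → ℝ}
    (hx : x ∈ relaxedSchedules d y) {θ : ℝ} (hθ : θ ∈ Set.Ioc (0 : ℝ) 1) :
    thresholdRounding x θ ∈ schedules d y := by
  obtain ⟨h0, h1, h2⟩ := hx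
  have hsum : ∀ j, ∑ t, thresholdRounding x θ j t = 1 := fun j => by
    rw [← prefixSum_of_le _ le_rfl, prefixSum_thresholdRounding h0 hθ.1,
      prefixSum_of_le _ le_rfl, h1, if_pos hθ.2]
  refine ⟨fun j t => ?_, hsum, fun p hp t => ?_⟩
  · by_cases h : θ ∈ Set.Ioc (prefixSum (x j) t) (prefixSum (x j) (t + 1)) <;>
      simp [thresholdRounding, h]
  · have h := h2 p hp t
    rw [overlap_eq, h1] at h
    rw [overlap_eq, hsum, prefixSum_thresholdRounding h0 hθ.1, prefixSum_thresholdRounding h0 hθ.1]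
    -- Only `j` reaching `θ` by `t + d` while `i` has not by `t` would violate the bound, and `h`
    -- excludes it.
    split_ifs with ha hb hb <;> linarith

variable [Fintype J]

/-- The interval of `θ` that starts `j` at `t` has length `x j t`, so the mean cost of the rounding
is the cost of `x`. -/
theorem exists_schedule_cost_le {d : J → ℕ} {y : J → J → ℝ} {x : J → Fin T → ℝ}
    (hx : x ∈ relaxedSchedules d y) (c : J → Fin T → ℝ) :
    ∃ x' ∈ schedules d y, cost c x' ≤ cost c x := by
  have hz : ∀ j n, 0 ≤ prefixSum (x j) n := fun j n => by
    rw [← prefixSum_zero (x j)]; exact prefixSum_mono (hx.1 j) n.zero_le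
  have hz1 : ∀ j n, prefixSum (x j) n ≤ 1 := fun j n => by
    rw [← hx.2.1 j, ← prefixSum_of_le (x j) (le_max_right n T)]
    exact prefixSum_mono (hx.1 j) (le_max_left n T)
  have hint : ∀ j t, IntegrableOn (fun θ => thresholdRounding x θ j t) (Set.Ioc 0 1) :=
    fun j t => (integrable_const (1 : ℝ)).indicator measurableSet_Ioc
  have hval : ∀ j t, ∫ θ in Set.Ioc (0 : ℝ) 1, thresholdRounding x θ j t = x j t := by
    intro j t
    have hsub : Set.Ioc (prefixSum (x j) t) (prefixSum (x j) (t + 1)) ⊆ Set.Ioc 0 1 :=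
      Set.Ioc_subset_Ioc (hz _ _) (hz1 _ _)
    have := prefixSum_succ (x j) t
    have hxjt := hx.1 j t
    unfold thresholdRounding
    rw [integral_indicator_one measurableSet_Ioc, measureReal_restrict_apply measurableSet_Ioc,
      Set.inter_eq_left.mpr hsub, Real.volume_real_Ioc_of_le (by linarith)]
    linarith
  have hint' : IntegrableOn (fun θ => cost c (thresholdRounding x θ)) (Set.Ioc 0 1) :=
    integrable_finsetSum _ fun j _ => integrable_finsetSum _ fun t _ => (hint j t).const_mul _
  have hcost : ∫ θ in Set.Ioc (0 : ℝ) 1, cost c (thresholdRounding x θ) = cost c x := by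
    unfold cost
    rw [integral_finsetSum _ fun j _ => integrable_finsetSum _ fun t _ => (hint j t).const_mul _]
    refine Finset.sum_congr rfl fun j _ => ?_
    rw [integral_finsetSum _ fun t _ => (hint j t).const_mul _]
    refine Finset.sum_congr rfl fun t _ => ?_
    rw [integral_const_mul, hval]
  obtain ⟨θ, hθ, hle⟩ := exists_le_setAverage (μ := volume) (s := Set.Ioc (0 : ℝ) 1)
    (by simp) (by simp) hint'
  refine ⟨_, thresholdRounding_mem_schedules hx hθ, hle.trans_eq ?_⟩
  rw [setAverage_eq, hcost]
  simp

end Relaxation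

/-! ### Convexity, compactness and finiteness of the feasible sets. -/

section Geometry

variable {J : Type*} {T : ℕ}

theorem overlap_combo (x x' : J → Fin T → ℝ) (a b : ℝ) (i j : J) (n : ℕ) (t : Fin T) :
    overlap (a • x + b • x') i j n t = a * overlap x i j n t + b * overlap x' i j n t := by
  simp only [overlap, Pi.add_apply, Pi.smul_apply, smul_eq_mul, Finset.sum_add_distrib,
    ← Finset.mul_sum]
  ring

theorem convex_relaxedSchedules (d : J → ℕ) (y : J → J → ℝ) :
    Convex ℝ (relaxedSchedules (T := T) d y) := by
  rintro x ⟨h0, h1, h2⟩ x' ⟨h0', h1', h2'⟩ a b ha hb hab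
  refine ⟨fun j t => ?_, fun j => ?_, fun p hp t => ?_⟩
  · have := h0 j t
    have := h0' j t
    simp only [Pi.add_apply, Pi.smul_apply, smul_eq_mul]
    positivity
  · simp only [Pi.add_apply, Pi.smul_apply, smul_eq_mul, Finset.sum_add_distrib,
      ← Finset.mul_sum, h1, h1', mul_one, hab]
  · rw [overlap_combo]
    have := mul_le_mul_of_nonneg_left (h2 p hp t) ha
    have := mul_le_mul_of_nonneg_left (h2' p hp t) hb
    linarith

theorem le_one_of_mem_relaxedSchedules {d : J → ℕ} {y : J → J → ℝ} {x : J → Fin T → ℝ}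
    (hx : x ∈ relaxedSchedules d y) (j : J) (t : Fin T) : x j t ≤ 1 := by
  rw [← hx.2.1 j]
  exact Finset.single_le_sum (fun s _ => hx.1 j s) (Finset.mem_univ t)

theorem isCompact_relaxedSchedules (d : J → ℕ) (y : J → J → ℝ) :
    IsCompact (relaxedSchedules (T := T) d y) := by
  have hbox : IsCompact (Set.univ.pi fun _ : J => Set.univ.pi fun _ : Fin T => Set.Icc (0 : ℝ) 1) :=
    isCompact_univ_pi fun _ => isCompact_univ_pi fun _ => isCompact_Icc
  refine hbox.of_isClosed_subset ?_ fun x hx j _ t _ =>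
    ⟨hx.1 j t, le_one_of_mem_relaxedSchedules hx j t⟩
  simp only [relaxedSchedules, Set.ofPred_and, Set.ofPred_forall]
  refine .inter ?_ (.inter ?_ ?_)
  · exact isClosed_iInter fun j => isClosed_iInter fun t =>
      isClosed_le continuous_const (by fun_prop)
  · exact isClosed_iInter fun j => isClosed_eq (by fun_prop) continuous_const
  · refine isClosed_iInter fun p => isClosed_iInter fun _ => isClosed_iInter fun t =>
      isClosed_le ?_ continuous_const
    unfold overlap
    fun_prop

theorem finite_orderings (J : Type*) [Finite J] : (orderings J).Finite :=
  (Set.Finite.pi' fun _ => Set.Finite.pi' fun _ => Set.toFinite {(0 : ℝ), 1}).subset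
    fun _ hy i j => hy.1 i j

theorem nonempty_orderings (J : Type*) : (orderings J).Nonempty := by
  classical
  let _ : LinearOrder J := linearOrderOfSTO (WellOrderingRel (α := J))
  refine ⟨fun i j => if i < j then 1 else 0, fun i j => ?_, fun i => by simp, fun i j h => ?_,
    fun i j k _ _ _ => ?_⟩
  · dsimp only
    split_ifs <;> simp
  · rcases h.lt_or_gt with h | h <;> simp [h, h.not_gt]
  · dsimp only
    split_ifs with h1 h2 h3 <;> first | exact absurd (h1.trans h2) h3 | norm_num

theorem finite_schedules [Finite J] (d : J → ℕ) (y : J → J → ℝ) :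
    (schedules (T := T) d y).Finite :=
  (Set.Finite.pi' fun _ => Set.Finite.pi' fun _ => Set.toFinite {(0 : ℝ), 1}).subset
    fun _ hx j t => hx.1 j t

theorem mem_relaxedSchedules_of_mem_compactFeasible {d : J → ℕ} {cHat : J → Fin T → ℝ}
    {p : CompactPoint J T} (hp : p ∈ compactFeasible d cHat) : p.x ∈ relaxedSchedules d p.y := by
  obtain ⟨h1, h2, -, -, -, -, -, h0, -⟩ := hp
  refine ⟨h0, h1, fun q hq t => ?_⟩
  have h := h2 q.1 q.2 t
  rw [show p.y q.1 q.2 = 1 from hq] at h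
  linarith

theorem mem_orderings_of_mem_compactFeasible {d : J → ℕ} {cHat : J → Fin T → ℝ}
    {p : CompactPoint J T} (hp : p ∈ compactFeasible d cHat) : p.y ∈ orderings J := by
  obtain ⟨-, -, -, h1, h2, h3, h4, -⟩ := hp
  exact ⟨h4, h1, h2, h3⟩

theorem mem_compactFeasible {d : J → ℕ} {cHat : J → Fin T → ℝ} {p : CompactPoint J T}
    (hy : p.y ∈ orderings J) (hx : p.x ∈ relaxedSchedules d p.y) (hπ : 0 ≤ p.π)
    (hη : ∀ j t, 0 ≤ p.η j t) (hc : ∀ j t, cHat j t * p.x j t ≤ p.π + p.η j t) :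
    p ∈ compactFeasible d cHat := by
  refine ⟨hx.2.1, fun i j t => ?_, hc, hy.2.1, hy.2.2.1, hy.2.2.2, hy.1, hx.1, hη, hπ⟩
  rcases hy.1 i j with h | h
  -- The right-hand side is 2 here, and each of the two sums is at most 1.
  · rw [h, overlap_eq, hx.2.1]
    have h1 := prefixSum_mono (hx.1 i) (Nat.zero_le t)
    have h2 := prefixSum_mono (hx.1 j) (le_max_left (t + d i) T)
    rw [prefixSum_zero] at h1
    rw [prefixSum_of_le _ (le_max_right _ _), hx.2.1] at h2
    linarith
  · rw [h]
    have := hx.2.2 (i, j) h t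
    linarith

end Geometry

/-! ### Lagrangian duality for the adversary. -/

section Duality

variable {J : Type*} [Fintype J] {T : ℕ}

theorem cost_combo_right (c x x' : J → Fin T → ℝ) (a b : ℝ) :
    cost c (a • x + b • x') = a * cost c x + b * cost c x' := by
  simp only [cost, Finset.mul_sum, ← Finset.sum_add_distrib, Pi.add_apply, Pi.smul_apply,
    smul_eq_mul]
  exact Finset.sum_congr rfl fun j _ => Finset.sum_congr rfl fun t _ => by ring

theorem cost_comm (c x : J → Fin T → ℝ) : cost c x = cost x c := by
  simp only [cost, mul_comm]

theorem cost_combo_left (c c' x : J → Fin T → ℝ) (a b : ℝ) :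
    cost (a • c + b • c') x = a * cost c x + b * cost c' x := by
  rw [cost_comm, cost_combo_right, cost_comm x, cost_comm x]

theorem continuous_cost : Continuous fun q : (J → Fin T → ℝ) × (J → Fin T → ℝ) =>
    cost q.1 q.2 := by
  unfold cost
  fun_prop

/-- The Lagrangian of the adversary's problem, the budget constraint having multiplier `q.2`. -/
def lagrangian (cLow cHat : J → Fin T → ℝ) (Γ : ℝ) (q : (J → Fin T → ℝ) × ℝ)
    (δ : J → Fin T → ℝ) : ℝ :=
  cost (cLow + cHat * δ) q.1 + q.2 * (Γ - ∑ j, ∑ t, δ j t)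

theorem lagrangian_combo_left (cLow cHat : J → Fin T → ℝ) (Γ : ℝ) (q q' : (J → Fin T → ℝ) × ℝ)
    (δ : J → Fin T → ℝ) (a b : ℝ) :
    lagrangian cLow cHat Γ (a • q + b • q') δ =
      a * lagrangian cLow cHat Γ q δ + b * lagrangian cLow cHat Γ q' δ := by
  simp only [lagrangian, Prod.fst_add, Prod.smul_fst, Prod.snd_add, Prod.smul_snd,
    cost_combo_right, smul_eq_mul]
  ring

theorem lagrangian_combo_right (cLow cHat : J → Fin T → ℝ) (Γ : ℝ) (q : (J → Fin T → ℝ) × ℝ)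
    (δ δ' : J → Fin T → ℝ) {a b : ℝ} (hab : a + b = 1) :
    lagrangian cLow cHat Γ q (a • δ + b • δ') =
      a * lagrangian cLow cHat Γ q δ + b * lagrangian cLow cHat Γ q δ' := by
  have h : cLow + cHat * (a • δ + b • δ') = a • (cLow + cHat * δ) + b • (cLow + cHat * δ') := by
    conv_lhs => rw [← one_smul ℝ cLow, ← hab]
    rw [mul_add, mul_smul_comm, mul_smul_comm, smul_add, smul_add, add_smul]
    abel
  have h' : ∑ j, ∑ t, (a • δ + b • δ') j t = a * (∑ j, ∑ t, δ j t) + b * ∑ j, ∑ t, δ' j t := by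
    simp only [Pi.add_apply, Pi.smul_apply, smul_eq_mul, Finset.sum_add_distrib, ← Finset.mul_sum]
  rw [lagrangian, h, h', cost_combo_left, lagrangian, lagrangian]
  linear_combination (-q.2 * Γ) * hab

/-- Grouping by `δ` makes the maximization over the box separate entry by entry. -/
theorem lagrangian_eq (cLow cHat : J → Fin T → ℝ) (Γ : ℝ) (q : (J → Fin T → ℝ) × ℝ)
    (δ : J → Fin T → ℝ) :
    lagrangian cLow cHat Γ q δ = (∑ j, ∑ t, cLow j t * q.1 j t) + Γ * q.2 +
      ∑ j, ∑ t, (cHat j t * q.1 j t - q.2) * δ j t := by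
  have h : ∑ j, ∑ t, (cHat j t * q.1 j t - q.2) * δ j t =
      (∑ j, ∑ t, cHat j t * δ j t * q.1 j t) - q.2 * ∑ j, ∑ t, δ j t := by
    simp only [Finset.mul_sum, ← Finset.sum_sub_distrib]
    exact Finset.sum_congr rfl fun j _ => Finset.sum_congr rfl fun t _ => by ring
  rw [h, lagrangian, cost]
  simp only [Pi.add_apply, Pi.mul_apply, add_mul, Finset.sum_add_distrib]
  ring

theorem continuous_lagrangian (cLow cHat : J → Fin T → ℝ) (Γ : ℝ) :
    Continuous fun r : ((J → Fin T → ℝ) × ℝ) × (J → Fin T → ℝ) =>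
      lagrangian cLow cHat Γ r.1 r.2 := by
  unfold lagrangian
  refine .add (continuous_cost.comp (.prodMk ?_ ?_)) ?_ <;> fun_prop

theorem exists_lagrangian_saddlePoint (cLow cHat : J → Fin T → ℝ) (Γ : ℝ)
    {X : Set ((J → Fin T → ℝ) × ℝ)} (hX : X.Nonempty) (hconv : Convex ℝ X) (hcomp : IsCompact X) :
    ∃ q ∈ X, ∃ δ ∈ Set.Icc (0 : J → Fin T → ℝ) 1,
      IsSaddlePointOn X (Set.Icc 0 1) (lagrangian cLow cHat Γ) q δ := by
  have hc := continuous_lagrangian cLow cHat Γ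
  have hbox : IsCompact (Set.Icc (0 : J → Fin T → ℝ) 1) := by
    rw [← Set.pi_univ_Icc]
    refine isCompact_univ_pi fun j => ?_
    exact isCompact_Icc
  refine Sion.exists_isSaddlePointOn hX hconv hcomp
    (fun δ _ => Continuous.lowerSemicontinuous (by fun_prop) |>.lowerSemicontinuousOn _) (fun δ _ => ?_)
    (convex_Icc _ _) ⟨0, le_rfl, zero_le_one⟩ hbox
    (fun q _ => Continuous.upperSemicontinuous (by fun_prop) |>.upperSemicontinuousOn _) (fun q _ => ?_)
  · exact ConvexOn.quasiconvexOn ⟨hconv, fun q _ q' _ a b _ _ _ =>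
      (lagrangian_combo_left cLow cHat Γ q q' δ a b).le⟩
  · exact ConcaveOn.quasiconcaveOn ⟨convex_Icc _ _, fun δ _ δ' _ a b _ _ hab =>
      (lagrangian_combo_right cLow cHat Γ q δ δ' hab).ge⟩

/-- Weak duality: weight the constraints on `π + η` by `δ`. -/
theorem cost_le_compactObjective {d : J → ℕ} {cLow cHat : J → Fin T → ℝ} {Γ : ℝ}
    {p : CompactPoint J T} (hp : p ∈ compactFeasible d cHat) {c : J → Fin T → ℝ}
    (hc : c ∈ budgetedSet cLow cHat Γ) : cost c p.x ≤ compactObjective cLow Γ p := by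
  obtain ⟨δ, hδ, hsum, hcδ⟩ := hc
  obtain ⟨-, -, hdual, -, -, -, -, -, hη, hπ⟩ := hp
  have h1 : cost c p.x ≤ (∑ j, ∑ t, cLow j t * p.x j t) + (p.π * ∑ j, ∑ t, δ j t) +
      ∑ j, ∑ t, p.η j t := by
    simp only [cost, Finset.mul_sum, ← Finset.sum_add_distrib]
    refine Finset.sum_le_sum fun j _ => Finset.sum_le_sum fun t _ => ?_
    have h2 := mul_le_mul_of_nonneg_left (hdual j t) (hδ j t).1
    have h3 := mul_le_mul_of_nonneg_left (hδ j t).2 (hη j t)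
    rw [hcδ]
    linarith
  have h4 := mul_le_mul_of_nonneg_left hsum hπ
  rw [compactObjective]
  linarith

/-- Strong duality: some scenario is as bad as some point of the compact program. -/
theorem exists_compactObjective_le_cost {d : J → ℕ} (cLow cHat : J → Fin T → ℝ) {Γ : ℝ}
    (hΓ : 0 ≤ Γ) {y : J → J → ℝ} (hy : y ∈ orderings J)
    (hne : (relaxedSchedules (T := T) d y).Nonempty) :
    ∃ p ∈ compactFeasible d cHat, p.y = y ∧ ∃ c ∈ budgetedSet cLow cHat Γ,
      ∀ x ∈ relaxedSchedules d y, compactObjective cLow Γ p ≤ cost c x := by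
  -- A cap on `π` for compactness, large enough that at `π = M` every coefficient of `δ` is at most
  -- `-1`.
  set M : ℝ := 1 + ∑ j, ∑ t, |cHat j t| with hM
  have hM0 : 0 ≤ M := by positivity
  obtain ⟨⟨x, π⟩, ⟨hx, hπ⟩, δ, hδ, hsaddle⟩ := exists_lagrangian_saddlePoint cLow cHat Γ
    (hne.prod (Set.nonempty_Icc.mpr hM0)) ((convex_relaxedSchedules d y).prod (convex_Icc 0 M))
    ((isCompact_relaxedSchedules d y).prod isCompact_Icc)
  simp only at hx hπ
  have hδ0 : ∀ j t, 0 ≤ δ j t := fun j t => hδ.1 j t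
  have hbudget : ∑ j, ∑ t, δ j t ≤ Γ := by
    -- If `π < M`, raising it to `M` cannot lower the Lagrangian, so the budget slack is
    -- nonnegative. If `π = M`, comparison with `δ = 0` forces the sum of `δ` to be at most 0.
    rcases hπ.2.lt_or_eq with hlt | hπM
    · have h := hsaddle (x, M) ⟨hx, hM0, le_rfl⟩ δ hδ
      simp only [lagrangian] at h
      by_contra! hcon
      nlinarith [mul_pos (sub_pos.mpr hlt) (sub_pos.mpr hcon)]
    · have h := hsaddle (x, M) ⟨hx, hM0, le_rfl⟩ 0 ⟨le_rfl, zero_le_one⟩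
      rw [hπM, lagrangian_eq, lagrangian_eq] at h
      have h2 : ∑ j, ∑ t, (cHat j t * x j t - M) * δ j t ≤ ∑ j, ∑ t, -δ j t := by
        refine Finset.sum_le_sum fun j _ => Finset.sum_le_sum fun t _ => ?_
        have h3 : |cHat j t| ≤ ∑ j, ∑ t, |cHat j t| :=
          (Finset.single_le_sum (f := fun t => |cHat j t|) (fun _ _ => abs_nonneg _)
            (Finset.mem_univ t)).trans
          (Finset.single_le_sum (f := fun j => ∑ t, |cHat j t|)
            (fun _ _ => Finset.sum_nonneg fun _ _ => abs_nonneg _) (Finset.mem_univ j))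
        have h4 : cHat j t * x j t ≤ |cHat j t| :=
          (mul_le_mul_of_nonneg_right (le_abs_self _) (hx.1 j t)).trans
            (mul_le_of_le_one_right (abs_nonneg _) (le_one_of_mem_relaxedSchedules hx j t))
        nlinarith [hδ0 j t]
      simp only [Pi.zero_apply, mul_zero, Finset.sum_const_zero, Finset.sum_neg_distrib] at h h2
      linarith
  let p : CompactPoint J T := ⟨x, y, π, fun j t => max (cHat j t * x j t - π) 0⟩
  refine ⟨p, mem_compactFeasible hy hx hπ.1 (fun j t => le_max_right _ _) (fun j t => ?_), rfl,
    cLow + cHat * δ, ⟨δ, fun j t => ⟨hδ0 j t, hδ.2 j t⟩, hbudget, fun j t => rfl⟩, fun x' hx' => ?_⟩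
  · have := le_max_left (cHat j t * x j t - π) 0
    change _ ≤ π + max _ _
    linarith
  -- `δ'` maximizes the Lagrangian at `(x, π)`, with value the objective of `p`; playing `(x', 0)`
  -- against `δ` removes the budget term and leaves the cost of `x'`.
  · let δ' : J → Fin T → ℝ := fun j t => if 0 ≤ cHat j t * x j t - π then 1 else 0
    have hδ' : δ' ∈ Set.Icc 0 1 := by
      constructor <;> intro j t <;> simp only [δ'] <;> split_ifs <;> simp
    have h := hsaddle (x', 0) ⟨hx', le_rfl, hM0⟩ δ' hδ'
    rw [lagrangian_eq, lagrangian, zero_mul, add_zero] at h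
    refine le_trans (le_of_eq ?_) h
    rw [compactObjective]
    refine congrArg _ (Finset.sum_congr rfl fun j _ => Finset.sum_congr rfl fun t _ => ?_)
    change max _ _ = _ * ite _ _ _
    split_ifs with h0
    · rw [mul_one, max_eq_left h0]
    · rw [mul_zero, max_eq_right (not_le.mp h0).le]

/-! ### Equality of the extended-real values and attainment. -/

theorem nonempty_budgetedSet (cLow cHat : J → Fin T → ℝ) {Γ : ℝ} (hΓ : 0 ≤ Γ) :
    (budgetedSet cLow cHat Γ).Nonempty :=
  ⟨cLow, 0, by simp, by simpa using hΓ, by simp⟩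

theorem schedules_nonempty_of_mem_compactFeasible {d : J → ℕ} {cHat : J → Fin T → ℝ}
    {p : CompactPoint J T} (hp : p ∈ compactFeasible d cHat) :
    (schedules (T := T) d p.y).Nonempty :=
  let ⟨x, hx, _⟩ := exists_schedule_cost_le (mem_relaxedSchedules_of_mem_compactFeasible hp) 0
  ⟨x, hx⟩

theorem recourseValue_of_not_nonempty {d : J → ℕ} {y : J → J → ℝ}
    (h : ¬ (schedules (T := T) d y).Nonempty) (c : J → Fin T → ℝ) :
    recourseValue d y c = ⊤ := by
  rw [recourseValue, Set.not_nonempty_iff_eq_empty.mp h]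
  simp

theorem worstCaseValue_of_not_nonempty {d : J → ℕ} {cLow cHat : J → Fin T → ℝ} {Γ : ℝ}
    (hΓ : 0 ≤ Γ) {y : J → J → ℝ} (h : ¬ (schedules (T := T) d y).Nonempty) :
    worstCaseValue d cLow cHat Γ y = ⊤ := by
  simp only [worstCaseValue, recourseValue_of_not_nonempty h]
  -- A supremum over no scenarios would be `⊥`; `0 ≤ Γ` rules this out.
  exact biSup_const (nonempty_budgetedSet cLow cHat hΓ)

theorem worstCaseValue_le_compactObjective {d : J → ℕ} {cLow cHat : J → Fin T → ℝ} {Γ : ℝ}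
    {p : CompactPoint J T} (hp : p ∈ compactFeasible d cHat) :
    worstCaseValue d cLow cHat Γ p.y ≤ compactObjective cLow Γ p := by
  refine iSup₂_le fun c hc => ?_
  obtain ⟨x, hx, hle⟩ :=
    exists_schedule_cost_le (mem_relaxedSchedules_of_mem_compactFeasible hp) c
  exact (iInf₂_le x hx).trans
    (EReal.coe_le_coe_iff.mpr (hle.trans (cost_le_compactObjective hp hc)))

/-- The chain objective ≤ recourse value ≤ worst-case value ≤ objective collapses to equalities. -/
theorem exists_compactObjective_eq_worstCaseValue {d : J → ℕ} (cLow cHat : J → Fin T → ℝ)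
    {Γ : ℝ} (hΓ : 0 ≤ Γ) {y : J → J → ℝ} (hy : y ∈ orderings J)
    (hne : (schedules (T := T) d y).Nonempty) :
    ∃ p ∈ compactFeasible d cHat, p.y = y ∧
      worstCaseValue d cLow cHat Γ y = compactObjective cLow Γ p ∧
      ∃ c ∈ budgetedSet cLow cHat Γ, recourseValue d y c = worstCaseValue d cLow cHat Γ y := by
  have hsub := schedules_subset_relaxedSchedules (T := T) d y
  obtain ⟨p, hp, rfl, c, hc, hle⟩ :=
    exists_compactObjective_le_cost cLow cHat hΓ hy (hne.mono hsub)
  have h1 : (compactObjective cLow Γ p : EReal) ≤ recourseValue d p.y c :=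
    le_iInf₂ fun x hx => EReal.coe_le_coe_iff.mpr (hle x (hsub hx))
  have h2 : recourseValue d p.y c ≤ worstCaseValue d cLow cHat Γ p.y := le_iSup₂_of_le c hc le_rfl
  have h3 := worstCaseValue_le_compactObjective (cLow := cLow) (Γ := Γ) hp
  exact ⟨p, hp, rfl, h3.antisymm (h1.trans h2), c, hc, h2.antisymm (h3.trans h1)⟩

theorem worstCaseValue_eq_iInf (d : J → ℕ) (cLow cHat : J → Fin T → ℝ) {Γ : ℝ} (hΓ : 0 ≤ Γ)
    {y : J → J → ℝ} (hy : y ∈ orderings J) :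
    worstCaseValue d cLow cHat Γ y =
      ⨅ p ∈ {p ∈ compactFeasible d cHat | p.y = y}, (compactObjective cLow Γ p : EReal) := by
  refine le_antisymm (le_iInf₂ ?_) ?_
  · rintro p ⟨hp, rfl⟩
    exact worstCaseValue_le_compactObjective hp
  · by_cases hne : (schedules (T := T) d y).Nonempty
    · obtain ⟨p, hp, hpy, hval, -⟩ := exists_compactObjective_eq_worstCaseValue cLow cHat hΓ hy hne
      rw [hval]
      exact iInf₂_le p ⟨hp, hpy⟩
    · rw [worstCaseValue_of_not_nonempty hΓ hne]
      exact le_top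

theorem twoStageValue_eq_compactValue (d : J → ℕ) (cLow cHat : J → Fin T → ℝ) {Γ : ℝ}
    (hΓ : 0 ≤ Γ) : twoStageValue d cLow cHat Γ = compactValue d cLow cHat Γ := by
  refine le_antisymm (le_iInf₂ fun p hp => ?_) (le_iInf₂ fun y hy => ?_)
  · exact (iInf₂_le p.y (mem_orderings_of_mem_compactFeasible hp)).trans
      (worstCaseValue_le_compactObjective hp)
  · rw [worstCaseValue_eq_iInf d cLow cHat hΓ hy]
    exact le_iInf₂ fun p hp => iInf₂_le p hp.1

theorem exists_worstCaseValue_eq_twoStageValue (d : J → ℕ) (cLow cHat : J → Fin T → ℝ) (Γ : ℝ) :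
    ∃ y ∈ orderings J, worstCaseValue d cLow cHat Γ y = twoStageValue d cLow cHat Γ := by
  obtain ⟨y, hy, hmin⟩ := Set.exists_min_image _ (worstCaseValue d cLow cHat Γ)
    (finite_orderings J) (nonempty_orderings J)
  exact ⟨y, hy, (le_iInf₂ hmin).antisymm (iInf₂_le y hy)⟩

theorem isOptimalOrdering_iff (d : J → ℕ) (cLow cHat : J → Fin T → ℝ) {Γ : ℝ} (hΓ : 0 ≤ Γ)
    (y : J → J → ℝ) :
    IsOptimalOrdering d cLow cHat Γ y ↔ ∃ p, IsCompactOptimal d cLow cHat Γ p ∧ p.y = y := by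
  constructor
  · rintro ⟨hy, hne, hmin⟩
    obtain ⟨p, hp, hpy, hval, -⟩ := exists_compactObjective_eq_worstCaseValue cLow cHat hΓ hy hne
    refine ⟨p, ⟨hp, fun q hq => EReal.coe_le_coe_iff.mp ?_⟩, hpy⟩
    rw [← hval]
    exact (hmin q.y (mem_orderings_of_mem_compactFeasible hq)).trans
      (worstCaseValue_le_compactObjective hq)
  · rintro ⟨p, ⟨hp, hmin⟩, rfl⟩
    refine ⟨mem_orderings_of_mem_compactFeasible hp, schedules_nonempty_of_mem_compactFeasible hp,
      fun y' hy' => (worstCaseValue_le_compactObjective hp).trans ?_⟩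
    rw [worstCaseValue_eq_iInf d cLow cHat hΓ hy']
    exact le_iInf₂ fun q hq => EReal.coe_le_coe_iff.mpr (hmin q hq.1)

/-- The feasible set is unbounded in `π` and `η`, so the optimum is obtained from a best ordering,
whose value is finite because `q` bounds it. -/
theorem exists_isCompactOptimal {d : J → ℕ} (cLow : J → Fin T → ℝ) {cHat : J → Fin T → ℝ} {Γ : ℝ}
    (hΓ : 0 ≤ Γ) (hne : (compactFeasible (T := T) d cHat).Nonempty) :
    ∃ p, IsCompactOptimal d cLow cHat Γ p := by
  obtain ⟨q, hq⟩ := hne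
  have hqy := mem_orderings_of_mem_compactFeasible hq
  obtain ⟨y, hy, hval⟩ := exists_worstCaseValue_eq_twoStageValue d cLow cHat Γ
  have hsched : (schedules (T := T) d y).Nonempty := by
    by_contra hcon
    rw [worstCaseValue_of_not_nonempty hΓ hcon] at hval
    have h : (⊤ : EReal) ≤ compactObjective cLow Γ q :=
      hval.trans_le ((iInf₂_le q.y hqy).trans (worstCaseValue_le_compactObjective hq))
    exact EReal.coe_ne_top _ (top_le_iff.mp h)
  have hopt : IsOptimalOrdering d cLow cHat Γ y :=
    ⟨hy, hsched, fun y' hy' => hval.trans_le (iInf₂_le y' hy')⟩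
  obtain ⟨p, hp, -⟩ := (isOptimalOrdering_iff d cLow cHat hΓ y).mp hopt
  exact ⟨p, hp⟩

theorem exists_recourseValue_eq_worstCaseValue (d : J → ℕ) (cLow cHat : J → Fin T → ℝ) {Γ : ℝ}
    (hΓ : 0 ≤ Γ) {y : J → J → ℝ} (hy : y ∈ orderings J) :
    ∃ c ∈ budgetedSet cLow cHat Γ, recourseValue d y c = worstCaseValue d cLow cHat Γ y := by
  by_cases hne : (schedules (T := T) d y).Nonempty
  · obtain ⟨-, -, -, -, h⟩ := exists_compactObjective_eq_worstCaseValue cLow cHat hΓ hy hne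
    exact h
  · obtain ⟨c, hc⟩ := nonempty_budgetedSet cLow cHat hΓ
    exact ⟨c, hc, by rw [recourseValue_of_not_nonempty hne, worstCaseValue_of_not_nonempty hΓ hne]⟩

theorem exists_cost_eq_recourseValue {d : J → ℕ} {y : J → J → ℝ}
    (hne : (schedules (T := T) d y).Nonempty) (c : J → Fin T → ℝ) :
    ∃ x ∈ schedules (T := T) d y, (cost c x : EReal) = recourseValue d y c := by
  obtain ⟨x, hx, hmin⟩ := Set.exists_min_image _ (cost c) (finite_schedules d y) hne
  exact ⟨x, hx, (le_iInf₂ fun x' hx' => EReal.coe_le_coe_iff.mpr (hmin x' hx')).antisymm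
    (iInf₂_le x hx)⟩

end Duality

end RobustScheduling

theorem mainTheorem3 {J : Type*} [Fintype J] (T : ℕ) (d : J → ℕ)
    (cLow cHat : J → Fin T → ℝ) (Γ : ℝ) (hΓ : 0 ≤ Γ) :
    -- the optimal values agree
    RobustScheduling.twoStageValue d cLow cHat Γ =
      RobustScheduling.compactValue d cLow cHat Γ ∧
    -- for every ordering, the two problems restricted to that ordering are both feasible or
    -- both infeasible, and have the same value
    (∀ y ∈ RobustScheduling.orderings J,
      ((RobustScheduling.schedules (T := T) d y).Nonempty ↔
        ∃ p ∈ RobustScheduling.compactFeasible d cHat, p.y = y) ∧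
      RobustScheduling.worstCaseValue d cLow cHat Γ y =
        ⨅ p ∈ {p ∈ RobustScheduling.compactFeasible d cHat | p.y = y},
          (RobustScheduling.compactObjective cLow Γ p : EReal)) ∧
    -- an ordering is optimal for the two-stage problem iff it is the ordering of an optimal
    -- solution of the compact program
    (∀ y : J → J → ℝ,
      RobustScheduling.IsOptimalOrdering d cLow cHat Γ y ↔
        ∃ p, RobustScheduling.IsCompactOptimal d cLow cHat Γ p ∧ p.y = y) ∧
    -- all minima and maxima in the two-stage problem are attained
    (∃ y ∈ RobustScheduling.orderings J,
      RobustScheduling.worstCaseValue d cLow cHat Γ y =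
        RobustScheduling.twoStageValue d cLow cHat Γ) ∧
    (∀ y ∈ RobustScheduling.orderings J,
      ∃ c ∈ RobustScheduling.budgetedSet cLow cHat Γ,
        RobustScheduling.recourseValue d y c =
          RobustScheduling.worstCaseValue d cLow cHat Γ y) ∧
    (∀ y ∈ RobustScheduling.orderings J,
      (RobustScheduling.schedules (T := T) d y).Nonempty →
      ∀ c : J → Fin T → ℝ, ∃ x ∈ RobustScheduling.schedules (T := T) d y,
        (RobustScheduling.cost c x : EReal) = RobustScheduling.recourseValue d y c) ∧
    -- the compact program has an optimal solution whenever it is feasible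
    ((RobustScheduling.compactFeasible (T := T) d cHat).Nonempty →
      ∃ p, RobustScheduling.IsCompactOptimal d cLow cHat Γ p) := by
  refine ⟨RobustScheduling.twoStageValue_eq_compactValue d cLow cHat hΓ, fun y hy => ⟨⟨fun hne => ?_,
    ?_⟩, RobustScheduling.worstCaseValue_eq_iInf d cLow cHat hΓ hy⟩,
    RobustScheduling.isOptimalOrdering_iff d cLow cHat hΓ,
    RobustScheduling.exists_worstCaseValue_eq_twoStageValue d cLow cHat Γ,
    fun y hy => RobustScheduling.exists_recourseValue_eq_worstCaseValue d cLow cHat hΓ hy,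
    fun y _ hne c => RobustScheduling.exists_cost_eq_recourseValue hne c,
    RobustScheduling.exists_isCompactOptimal cLow hΓ⟩
  · obtain ⟨p, hp, hpy, -⟩ :=
      RobustScheduling.exists_compactObjective_eq_worstCaseValue cLow cHat hΓ hy hne
    exact ⟨p, hp, hpy⟩
  · rintro ⟨p, hp, rfl⟩
    exact RobustScheduling.schedules_nonempty_of_mem_compactFeasible hp
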